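/- Let $(A,\rho,[\cdot,\cdot]_\mu)$ be a Lie algebroid over a smooth manifold $M$ ($A\to M$ a finite-rank smooth real vector bundle), with differential $d_\mu$ on $\Gamma(\wedge^\bullet A^*)$. For a $2$-form $\omega$ on $A$ let $\omega^\flat X=-i_X\omega$, and for a bivector $\sigma$ let $\sigma^\sharp\alpha=i_\alpha\sigma$. Let $\{\cdot,\cdot\}$ be the big bracket on $\Gamma(\wedge^\bullet A\otimes\wedge^\bullet A^*)=\Gamma(\wedge^\bullet(A\oplus A^*))$, that is, the $C^\infty(M)$-bilinear even graded Poisson bracket, a graded biderivation with $$\{u,v\}=-(-1)^{|u||v|}\{v,u\},\qquad \{u,v\wedge w\}=\{u,v\}\wedge w+(-1)^{|u||v|}\,v\wedge\{u,w\},$$ such that $\{\alpha,X\}=\{X,\alpha\}=\langle\alpha,X\rangle$, $\{X,Y\}=0$, $\{\alpha,\beta\}=0$ for $X,Y\in\Gamma A$ and $\alpha,\beta\in\Gamma(A^*)$. For a $(1,1)$-tensor $N:A\to A$ the Nijenhuis torsion is $$(\mathcal T_\mu N)(X,Y)=[NX,NY]_\mu-N\big([NX,Y]_\mu+[X,NY]_\mu\big)+N^2[X,Y]_\mu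 .$$ It is identified with the section $\mathcal T_\mu N$ of $\wedge^2A^*\otimes A$ determined by $\{\{X,\mathcal T_\mu N\},Y\}=(\mathcal T_\mu N)(X,Y)$. Let $(\omega,N)$ be a Hitchin pair on $A$: $\omega$ is a non-degenerate $2$-form with $d_\mu\omega=0$, $N$ is a $(1,1)$-tensor with $\omega^\flat\circ N=N^*\circ\omega^\flat$, and $d_\mu(\omega_N)=0$, where $\omega_N$ is the $2$-form $\omega_N=\tfrac12 i_N\omega$, $(i_N\omega)(X,Y)=\omega(NX,Y)+\omega(X,NY)$, equivalently $\omega_N^\flat=\omega^\flat\circ N$. Let $\sigma$ be the bivector inverse to $\omega$, that is, $\sigma^\sharp\circ\omega^\flat=\mathrm{Id}_A$, and let $$\lambda=-\big(\omega+(\omega_N)_N\big),\qquad (\omega_N)_N=\tfrac14\, i_N(i_N\omega),$$ be the twist of $(\omega,N)$. Then $$\mathcal T_\mu N=\{d_\mu\lambda,\sigma\}\;\big(=-\{\sigma,d_\mu\lambda\}\big).$$ -/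

import Mathlib

open Bundle Module
open scoped Manifold ContDiff

noncomputable section

/-! ### The big bracket on the tensor algebra of a vector space -/

section Algebra

variable {W : Type*} [AddCommGroup W] [Module ℝ W] {n : ℕ}

/-- The exterior algebra `Λ(W ⊕ W*) = ΛW ⊗ ΛW*`. -/
abbrev TensorAlg (W : Type*) [AddCommGroup W] [Module ℝ W] : Type _ :=
  ExteriorAlgebra ℝ (W × Dual ℝ W)

/-- A vector, as an element of `Λ(W ⊕ W*)`. -/
def vecElt : W →ₗ[ℝ] TensorAlg W :=
  (ExteriorAlgebra.ι ℝ) ∘ₗ LinearMap.inl ℝ W (Dual ℝ W)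

/-- A covector, as an element of `Λ(W ⊕ W*)`. -/
def covecElt : Dual ℝ W →ₗ[ℝ] TensorAlg W :=
  (ExteriorAlgebra.ι ℝ) ∘ₗ LinearMap.inr ℝ W (Dual ℝ W)

/-- Write `θ_a` for the elements of a basis `b` of `W` and `ξ^a` for the dual basis.  This is the
linear form on `W ⊕ W*` which defines the partial derivative `∂/∂θ_a`. -/
def dTheta (b : Basis (Fin n) ℝ W) (a : Fin n) : Dual ℝ (W × Dual ℝ W) :=
  (b.coord a) ∘ₗ LinearMap.fst ℝ W (Dual ℝ W)

/-- The linear form on `W ⊕ W*` which defines the partial derivative `∂/∂ξ^a`. -/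
def dXi (b : Basis (Fin n) ℝ W) (a : Fin n) : Dual ℝ (W × Dual ℝ W) :=
  (Dual.eval ℝ W (b a)) ∘ₗ LinearMap.snd ℝ W (Dual ℝ W)

/-- The big bracket on `Λ(W ⊕ W*)`: the even Poisson bracket
`{u, v} = ∑ₐ (u ∂/∂ξ^a) (∂/∂θ_a v) + (u ∂/∂θ_a) (∂/∂ξ^a v)` (derivatives of `u` acting from the
right, derivatives of `v` acting from the left).  It does not depend on the basis `b`: it is the
graded biderivation such that `{ξ^a, θ_b} = {θ_b, ξ^a} = δ^a_b`,
`{ξ^a, ξ^b} = {θ_a, θ_b} = 0`. -/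
def bigBracket (b : Basis (Fin n) ℝ W) (u v : TensorAlg W) : TensorAlg W :=
  ∑ a, (CliffordAlgebra.contractRight u (dXi b a) * CliffordAlgebra.contractLeft (dTheta b a) v +
    CliffordAlgebra.contractRight u (dTheta b a) * CliffordAlgebra.contractLeft (dXi b a) v)

/-- The element `(1/k!) ψ_{a₁…a_k} ξ^{a₁} ⋯ ξ^{a_k}` of `Λ^k W*` given by a `k`-form `ψ`. -/
def formElt (b : Basis (Fin n) ℝ W) {k : ℕ} (ψ : W [⋀^Fin k]→ₗ[ℝ] ℝ) : TensorAlg W :=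
  ((k.factorial : ℝ)⁻¹) • ∑ i : Fin k → Fin n,
    ψ (fun j => b (i j)) • (List.ofFn fun j => covecElt (b.coord (i j))).prod

/-- The element `(1/2) σ^{ac} θ_a θ_c` of `Λ² W` given by an alternating bilinear form `σ` on
`W*`. -/
def bivectorElt (b : Basis (Fin n) ℝ W) (σ : Dual ℝ W [⋀^Fin 2]→ₗ[ℝ] ℝ) : TensorAlg W :=
  (2 : ℝ)⁻¹ • ∑ a, ∑ c, σ ![b.coord a, b.coord c] • (vecElt (b a) * vecElt (b c))

/-- The element `τ` of `Λ² W* ⊗ W` which represents a skew-symmetric bilinear map `T` from `W` to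
`W` in the sense that `{{X, τ}, Y} = T(X, Y)`; see `bigBracket_torsionElt`. -/
def torsionElt (b : Basis (Fin n) ℝ W) (T : W [⋀^Fin 2]→ₗ[ℝ] W) : TensorAlg W :=
  (2 : ℝ)⁻¹ • ∑ a, ∑ c,
    covecElt (b.coord c) * covecElt (b.coord a) * vecElt (T ![b a, b c])

theorem contractLeft_vecElt (d : Dual ℝ (W × Dual ℝ W)) (X : W) :
    CliffordAlgebra.contractLeft d (vecElt X) = algebraMap ℝ (TensorAlg W) (d (X, 0)) :=
  CliffordAlgebra.contractLeft_ι _ _ _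

theorem contractRight_vecElt (d : Dual ℝ (W × Dual ℝ W)) (X : W) :
    CliffordAlgebra.contractRight (vecElt X) d = algebraMap ℝ (TensorAlg W) (d (X, 0)) :=
  CliffordAlgebra.contractRight_ι _ _ _

theorem contractRight_covecElt (d : Dual ℝ (W × Dual ℝ W)) (α : Dual ℝ W) :
    CliffordAlgebra.contractRight (covecElt α) d = algebraMap ℝ (TensorAlg W) (d (0, α)) :=
  CliffordAlgebra.contractRight_ι _ _ _

theorem contractLeft_covecElt_mul (d : Dual ℝ (W × Dual ℝ W)) (α : Dual ℝ W) (u : TensorAlg W) :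
    CliffordAlgebra.contractLeft d (covecElt α * u) =
      d (0, α) • u - covecElt α * CliffordAlgebra.contractLeft d u :=
  CliffordAlgebra.contractLeft_ι_mul _ _ _

theorem contractRight_mul_vecElt (d : Dual ℝ (W × Dual ℝ W)) (X : W) (u : TensorAlg W) :
    CliffordAlgebra.contractRight (u * vecElt X) d =
      d (X, 0) • u - CliffordAlgebra.contractRight u d * vecElt X :=
  CliffordAlgebra.contractRight_mul_ι _ _ _

theorem sum_coord_mul_coord (b : Basis (Fin n) ℝ W) (X : W) (α : Dual ℝ W) :
    ∑ a, b.coord a X * α (b a) = α X := by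
  have h := congrArg α (b.sum_repr X)
  rw [map_sum] at h
  simpa [-Basis.sum_repr] using h

theorem bigBracket_vecElt_left (b : Basis (Fin n) ℝ W) (X : W) (v : TensorAlg W) :
    bigBracket b (vecElt X) v =
      CliffordAlgebra.contractLeft ((Dual.eval ℝ W X) ∘ₗ LinearMap.snd ℝ W (Dual ℝ W)) v := by
  have h : (Dual.eval ℝ W X) ∘ₗ LinearMap.snd ℝ W (Dual ℝ W) =
      ∑ a, b.coord a X • dXi b a := by
    ext p
    · simp [dXi]
    · simpa [dXi] using (sum_coord_mul_coord b X p).symm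
  rw [h]
  simp [bigBracket, contractRight_vecElt, dXi, dTheta, Algebra.smul_def]

theorem bigBracket_vecElt_right (b : Basis (Fin n) ℝ W) (Y : W) (u : TensorAlg W) :
    bigBracket b u (vecElt Y) =
      CliffordAlgebra.contractRight u
        ((Dual.eval ℝ W Y) ∘ₗ LinearMap.snd ℝ W (Dual ℝ W)) := by
  have h : (Dual.eval ℝ W Y) ∘ₗ LinearMap.snd ℝ W (Dual ℝ W) =
      ∑ a, b.coord a Y • dXi b a := by
    ext p
    · simp [dXi]
    · simpa [dXi] using (sum_coord_mul_coord b Y p).symm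
  rw [h]
  simp [bigBracket, contractLeft_vecElt, dXi, dTheta, Algebra.smul_def, Algebra.commutes]

theorem alternatingTwo_swap {A : Type*} [AddCommGroup A] [Module ℝ A] (T : W [⋀^Fin 2]→ₗ[ℝ] A)
    (X Y : W) : T ![X, Y] = -T ![Y, X] := by
  have h := T.map_swap ![Y, X] (show (0 : Fin 2) ≠ 1 by decide)
  rw [← h]
  congr 1
  ext i
  fin_cases i <;> rfl

theorem alternatingTwo_expand {A : Type*} [AddCommGroup A] [Module ℝ A] (b : Basis (Fin n) ℝ W)
    (T : W [⋀^Fin 2]→ₗ[ℝ] A) (X Y : W) :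
    T ![X, Y] = ∑ a, ∑ c, (b.coord a X * b.coord c Y) • T ![b a, b c] := by
  have h1 : ∀ X Y : W, T ![X, Y] = ∑ a, b.coord a X • T ![b a, Y] := by
    intro X Y
    let g : W →ₗ[ℝ] A :=
      { toFun := fun Z => T ![Z, Y]
        map_add' := fun Z Z' => T.map_vecCons_add ![Y] Z Z'
        map_smul' := fun r Z => T.map_vecCons_smul ![Y] r Z }
    have h := congrArg g (b.sum_repr X)
    rw [map_sum] at h
    simp only [map_smul] at h
    exact h.symm
  rw [h1]
  refine Finset.sum_congr rfl fun a _ => ?_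
  rw [alternatingTwo_swap, h1, ← Finset.sum_neg_distrib, Finset.smul_sum]
  refine Finset.sum_congr rfl fun c _ => ?_
  rw [alternatingTwo_swap T (b a) (b c), mul_smul]
  simp

/-- The identification of skew-symmetric bilinear maps with elements of `Λ² W* ⊗ W`. -/
theorem bigBracket_torsionElt (b : Basis (Fin n) ℝ W) (T : W [⋀^Fin 2]→ₗ[ℝ] W) (X Y : W) :
    bigBracket b (bigBracket b (vecElt X) (torsionElt b T)) (vecElt Y) = vecElt (T ![X, Y]) := by
  rw [bigBracket_vecElt_left, bigBracket_vecElt_right, torsionElt]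
  have key : ∀ (α β : Dual ℝ W) (Z : W), CliffordAlgebra.contractRight
      (CliffordAlgebra.contractLeft ((Dual.eval ℝ W X) ∘ₗ LinearMap.snd ℝ W (Dual ℝ W))
        (covecElt α * covecElt β * vecElt Z))
      ((Dual.eval ℝ W Y) ∘ₗ LinearMap.snd ℝ W (Dual ℝ W)) =
      (β X * α Y - α X * β Y) • vecElt Z := by
    intro α β Z
    rw [mul_assoc, contractLeft_covecElt_mul, contractLeft_covecElt_mul, contractLeft_vecElt]
    simp only [map_sub, map_smul, LinearMap.sub_apply, LinearMap.smul_apply,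
      contractRight_mul_vecElt, contractRight_covecElt, LinearMap.comp_apply,
      LinearMap.snd_apply, Dual.eval_apply, map_zero, mul_zero, sub_zero,
      mul_smul_comm, zero_smul, zero_sub, smul_neg, ← Algebra.smul_def, sub_smul, mul_smul]
    abel
  simp only [map_smul, map_sum, LinearMap.smul_apply, LinearMap.sum_apply, key]
  have h1 := congrArg vecElt (alternatingTwo_expand b T X Y)
  have h2 := congrArg vecElt (alternatingTwo_expand b T Y X)
  rw [alternatingTwo_swap T Y X] at h2
  simp only [map_sum, map_smul, map_neg] at h1 h2
  have h3 : ∑ a, ∑ c, (b.coord a X * b.coord c Y - b.coord c X * b.coord a Y) •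
      vecElt (T ![b a, b c]) = (2 : ℝ) • vecElt (T ![X, Y]) := by
    rw [two_smul]
    nth_rewrite 1 [h1]
    rw [← sub_neg_eq_add, h2, ← Finset.sum_sub_distrib]
    refine Finset.sum_congr rfl fun a _ => ?_
    rw [← Finset.sum_sub_distrib]
    refine Finset.sum_congr rfl fun c _ => ?_
    rw [← sub_smul, mul_comm (b.coord a Y)]
  rw [h3, smul_smul]
  norm_num

end Algebra

/-! ### Alternating maps from skew-symmetric functions -/

section Alternating

variable {U A : Type*} [AddCommGroup U] [Module ℝ U] [AddCommGroup A] [Module ℝ A]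

theorem eq_zero_of_eq_neg {A : Type*} [AddCommGroup A] [Module ℝ A] {a : A} (h : a = -a) :
    a = 0 := by
  have h2 : (2 : ℝ) • a = 0 := by
    rw [two_smul]
    nth_rewrite 2 [h]
    exact add_neg_cancel a
  simpa using h2

/-- A skew-symmetric function of two arguments, linear in the first one, as an alternating map. -/
def mkAltTwo (g : U → U → A) (hadd : ∀ X X' Y, g (X + X') Y = g X Y + g X' Y)
    (hsmul : ∀ (r : ℝ) X Y, g (r • X) Y = r • g X Y) (hskew : ∀ X Y, g X Y = -g Y X) :
    U [⋀^Fin 2]→ₗ[ℝ] A where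
  toFun m := g (m 0) (m 1)
  map_update_add' := by
    intro inst m i X X'
    obtain rfl : inst = instDecidableEqFin _ := Subsingleton.elim _ _
    fin_cases i
    · simpa using hadd X X' (m 1)
    · simp [hskew (m 0), hadd, add_comm]
  map_update_smul' := by
    intro inst m i r X
    obtain rfl : inst = instDecidableEqFin _ := Subsingleton.elim _ _
    fin_cases i
    · simpa using hsmul r X (m 1)
    · simp [hskew (m 0), hsmul]
  map_eq_zero_of_eq' := by
    intro m i j hm hij
    have h : ∀ X, g X X = 0 := fun X => eq_zero_of_eq_neg (hskew X X)
    clear hskew hadd hsmul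
    fin_cases i <;> fin_cases j <;> simp_all

/-- A skew-symmetric function of three arguments, linear in the first one, as an alternating
map. -/
def mkAltThree (g : U → U → U → A) (hadd : ∀ X X' Y Z, g (X + X') Y Z = g X Y Z + g X' Y Z)
    (hsmul : ∀ (r : ℝ) X Y Z, g (r • X) Y Z = r • g X Y Z)
    (h01 : ∀ X Y Z, g X Y Z = -g Y X Z) (h12 : ∀ X Y Z, g X Y Z = -g X Z Y) :
    U [⋀^Fin 3]→ₗ[ℝ] A where
  toFun m := g (m 0) (m 1) (m 2)
  map_update_add' := by
    intro inst m i X X'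
    obtain rfl : inst = instDecidableEqFin _ := Subsingleton.elim _ _
    have h02 : ∀ X Y Z, g X Y Z = -g Z Y X := fun X Y Z => by
      rw [h01, h12, h01, neg_neg]
    fin_cases i
    · simpa using hadd X X' (m 1) (m 2)
    · simp [h01 (m 0), hadd, add_comm]
    · simp [h02 (m 0), hadd, add_comm]
  map_update_smul' := by
    intro inst m i r X
    obtain rfl : inst = instDecidableEqFin _ := Subsingleton.elim _ _
    have h02 : ∀ X Y Z, g X Y Z = -g Z Y X := fun X Y Z => by
      rw [h01, h12, h01, neg_neg]
    fin_cases i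
    · simpa using hsmul r X (m 1) (m 2)
    · simp [h01 (m 0), hsmul]
    · simp [h02 (m 0), hsmul]
  map_eq_zero_of_eq' := by
    intro m i j hm hij
    have h02 : ∀ X Y Z, g X Y Z = -g Z Y X := fun X Y Z => by
      rw [h01, h12, h01, neg_neg]
    have k01 : ∀ X Z, g X X Z = 0 := fun X Z => eq_zero_of_eq_neg (h01 X X Z)
    have k12 : ∀ X Z, g X Z Z = 0 := fun X Z => eq_zero_of_eq_neg (h12 X Z Z)
    have k02 : ∀ X Z, g X Z X = 0 := fun X Z => eq_zero_of_eq_neg (h02 X Z X)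
    clear h01 h12 h02 hadd hsmul
    fin_cases i <;> fin_cases j <;> simp_all

end Alternating

/-! ### Lie algebroids and tensors on them -/

section Geometry

variable {E : Type*} [NormedAddCommGroup E] [NormedSpace ℝ E]
  {H : Type*} [TopologicalSpace H] {I : ModelWithCorners ℝ E H}
  {M : Type*} [TopologicalSpace M] [ChartedSpace H M]
  {F : Type*} [NormedAddCommGroup F] [NormedSpace ℝ F]
  {V : M → Type*} [TopologicalSpace (TotalSpace F V)]
  [∀ x, AddCommGroup (V x)] [∀ x, Module ℝ (V x)] [∀ x, TopologicalSpace (V x)]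
  [FiberBundle F V] [VectorBundle ℝ F V]

/-- The product `f X` of a smooth function and a smooth section. -/
def mulSection (f : C^∞⟮I, M; ℝ⟯) (X : Cₛ^∞⟮I; F, V⟯) : Cₛ^∞⟮I; F, V⟯ :=
  ⟨fun x => f x • X x, f.contMDiff.smul_section X.contMDiff⟩

variable (I F V) in
/-- A Lie algebroid structure on a smooth vector bundle `V → M`: a smooth bundle map
`V → TM` (the anchor) and a Lie bracket on the smooth sections of `V` with
`[X, f Y] = f [X, Y] + (ρ(X) f) Y`.  (These axioms imply that the anchor maps brackets to
brackets.) -/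
structure LieAlgebroid [IsManifold I ∞ M] where
  anchor : ∀ x, V x →ₗ[ℝ] TangentSpace I x
  anchor_smooth : ContMDiff (I.prod 𝓘(ℝ, F)) I.tangent ∞
    (fun p : TotalSpace F V => (⟨p.1, anchor p.1 p.2⟩ : TangentBundle I M))
  bracket : Cₛ^∞⟮I; F, V⟯ →ₗ[ℝ] Cₛ^∞⟮I; F, V⟯ →ₗ[ℝ] Cₛ^∞⟮I; F, V⟯
  bracket_self : ∀ X, bracket X X = 0
  jacobi : ∀ X Y Z, bracket X (bracket Y Z) = bracket (bracket X Y) Z + bracket Y (bracket X Z)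
  leibniz : ∀ (X : Cₛ^∞⟮I; F, V⟯) (f : C^∞⟮I, M; ℝ⟯) (Y : Cₛ^∞⟮I; F, V⟯) (x : M),
    bracket X (mulSection f Y) x =
      f x • bracket X Y x + (mvfderiv I f x (anchor x (X x))) • Y x

variable (I F V) in
/-- A `(1,1)`-tensor: a smooth endomorphism of the vector bundle `V`. -/
structure EndTensor where
  toFun : ∀ x, V x →ₗ[ℝ] V x
  smooth : ContMDiff (I.prod 𝓘(ℝ, F)) (I.prod 𝓘(ℝ, F)) ∞
    (fun p : TotalSpace F V => (⟨p.1, toFun p.1 p.2⟩ : TotalSpace F V))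

variable (I F V) in
/-- A `k`-form on `V`: a smooth section of `Λ^k V*`. -/
structure AForm (k : ℕ) where
  toFun : ∀ x, V x [⋀^Fin k]→ₗ[ℝ] ℝ
  smooth : ∀ X : Fin k → Cₛ^∞⟮I; F, V⟯,
    ContMDiff I 𝓘(ℝ, ℝ) ∞ (fun x => toFun x (fun i => X i x))

variable (I F V) in
/-- A bivector on `V`: a smooth section of `Λ² V`, viewed as a family of alternating bilinear forms
on the dual spaces. -/
structure Bivector where
  toFun : ∀ x, Dual ℝ (V x) [⋀^Fin 2]→ₗ[ℝ] ℝ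
  smooth : ∀ α : Fin 2 → ∀ x, Dual ℝ (V x),
    (∀ i, ∀ X : Cₛ^∞⟮I; F, V⟯, ContMDiff I 𝓘(ℝ, ℝ) ∞ (fun x => α i x (X x))) →
    ContMDiff I 𝓘(ℝ, ℝ) ∞ (fun x => toFun x (fun i => α i x))

/-- The action of a `(1,1)`-tensor on sections. -/
def EndTensor.onSection (N : EndTensor I F V) : Cₛ^∞⟮I; F, V⟯ →ₗ[ℝ] Cₛ^∞⟮I; F, V⟯ where
  toFun X := ⟨fun x => N.toFun x (X x), N.smooth.comp X.contMDiff⟩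
  map_add' X Y := by ext x; exact (N.toFun x).map_add _ _
  map_smul' r X := by ext x; exact (N.toFun x).map_smul _ _

/-- The smooth function `w(X, Y)`. -/
def AForm.evalTwo (w : AForm I F V 2) (X Y : Cₛ^∞⟮I; F, V⟯) : C^∞⟮I, M; ℝ⟯ :=
  ⟨fun x => w.toFun x ![X x, Y x], (w.smooth ![X, Y]).congr fun x => congrArg _ <| by
    ext i
    fin_cases i <;> rfl⟩

/-- The `2`-form `-(w + η)`. -/
def AForm.negAdd (w η : AForm I F V 2) : AForm I F V 2 where
  toFun x := -(w.toFun x + η.toFun x)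
  smooth X := ((w.smooth X).add (η.smooth X)).neg

/-- `w^♭ : V → V*`, with `w^♭ X = - i_X w`. -/
def AForm.flat (w : AForm I F V 2) (x : M) : V x →ₗ[ℝ] Dual ℝ (V x) :=
  LinearMap.mk₂ ℝ (fun X Y => -w.toFun x ![X, Y])
    (fun X X' Y => by rw [(w.toFun x).map_vecCons_add ![Y] X X']; ring)
    (fun r X Y => by rw [(w.toFun x).map_vecCons_smul ![Y] r X, smul_eq_mul, smul_eq_mul]; ring)
    (fun X Y Y' => by
      rw [alternatingTwo_swap, alternatingTwo_swap _ X Y, alternatingTwo_swap _ X Y',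
        (w.toFun x).map_vecCons_add ![X] Y Y']; ring)
    (fun r X Y => by
      rw [alternatingTwo_swap, alternatingTwo_swap _ X Y,
        (w.toFun x).map_vecCons_smul ![X] r Y, smul_eq_mul, smul_eq_mul]; ring)

/-- `(i_N w)(X, Y) = w(N X, Y) + w(X, N Y)`, that is, `i_N w = {N, w}`. -/
def AForm.insertEnd (N : EndTensor I F V) (w : AForm I F V 2) : AForm I F V 2 where
  toFun x := mkAltTwo
    (fun X Y => w.toFun x ![N.toFun x X, Y] + w.toFun x ![X, N.toFun x Y])
    (fun X X' Y => by
      rw [map_add, (w.toFun x).map_vecCons_add, (w.toFun x).map_vecCons_add]; ring)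
    (fun r X Y => by
      rw [map_smul, (w.toFun x).map_vecCons_smul, (w.toFun x).map_vecCons_smul, smul_add])
    (fun X Y => by
      rw [alternatingTwo_swap, alternatingTwo_swap _ X]; ring)
  smooth X := by
    have h1 := w.smooth ![N.onSection (X 0), X 1]
    have h2 := w.smooth ![X 0, N.onSection (X 1)]
    refine (h1.add h2).congr fun x => ?_
    refine congrArg₂ (fun s t : ℝ => s + t) (congrArg _ ?_) (congrArg _ ?_) <;>
    · ext i
      fin_cases i <;> rfl

/-- `w_N = (1/2) i_N w`; if `w^♭ ∘ N = N* ∘ w^♭` then `(w_N)^♭ = w^♭ ∘ N`, see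
`AForm.flat_deform`. -/
def AForm.deform (w : AForm I F V 2) (N : EndTensor I F V) : AForm I F V 2 where
  toFun x := (2 : ℝ)⁻¹ • (w.insertEnd N).toFun x
  smooth X := contMDiff_const.mul ((w.insertEnd N).smooth X)

theorem AForm.flat_deform (w : AForm I F V 2) (N : EndTensor I F V)
    (h : ∀ x, w.flat x ∘ₗ N.toFun x = (N.toFun x).dualMap ∘ₗ w.flat x) (x : M) :
    (w.deform N).flat x = w.flat x ∘ₗ N.toFun x := by
  ext X Y
  have h1 : -w.toFun x ![N.toFun x X, Y] = -w.toFun x ![X, N.toFun x Y] :=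
    LinearMap.congr_fun (LinearMap.congr_fun (h x) X) Y
  have h2 : (w.deform N).toFun x ![X, Y] =
      (2 : ℝ)⁻¹ * (w.toFun x ![N.toFun x X, Y] + w.toFun x ![X, N.toFun x Y]) := rfl
  have h3 : (w.deform N).flat x X Y = -(w.deform N).toFun x ![X, Y] := rfl
  have h4 : (w.flat x ∘ₗ N.toFun x) X Y = -w.toFun x ![N.toFun x X, Y] := rfl
  rw [h3, h4, h2]
  linarith

theorem AForm.evalTwo_add (w : AForm I F V 2) (X X' Y : Cₛ^∞⟮I; F, V⟯) :
    w.evalTwo (X + X') Y = w.evalTwo X Y + w.evalTwo X' Y := by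
  ext x
  exact (w.toFun x).map_vecCons_add ![Y x] (X x) (X' x)

theorem AForm.evalTwo_mul (w : AForm I F V 2) (f : C^∞⟮I, M; ℝ⟯) (X Y : Cₛ^∞⟮I; F, V⟯) :
    w.evalTwo (mulSection f X) Y = f * w.evalTwo X Y := by
  ext x
  exact (w.toFun x).map_vecCons_smul ![Y x] (f x) (X x)

theorem AForm.evalTwo_swap (w : AForm I F V 2) (X Y : Cₛ^∞⟮I; F, V⟯) :
    w.evalTwo X Y = -w.evalTwo Y X := by
  ext x
  exact alternatingTwo_swap (w.toFun x) (X x) (Y x)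

theorem AForm.evalTwo_neg (w : AForm I F V 2) (X Y : Cₛ^∞⟮I; F, V⟯) :
    w.evalTwo (-X) Y = -w.evalTwo X Y := by
  have h := w.evalTwo_add X (-X) Y
  have h0 := w.evalTwo_add 0 0 Y
  rw [add_zero] at h0
  have h1 : w.evalTwo 0 Y = 0 := by simpa using h0
  rw [add_neg_cancel, h1] at h
  exact eq_neg_of_add_eq_zero_right h.symm

theorem EndTensor.onSection_mul (N : EndTensor I F V) (f : C^∞⟮I, M; ℝ⟯)
    (X : Cₛ^∞⟮I; F, V⟯) : N.onSection (mulSection f X) = mulSection f (N.onSection X) := by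
  ext x
  exact (N.toFun x).map_smul _ _

variable [IsManifold I ∞ M]

/-- The function `ρ(X) f`. -/
def LieAlgebroid.act (A : LieAlgebroid I F V) (X : Cₛ^∞⟮I; F, V⟯) (f : C^∞⟮I, M; ℝ⟯) :
    C^∞⟮I, M; ℝ⟯ where
  val x := mvfderiv I f x (A.anchor x (X x))
  property := by
    have h1 : ContMDiff I I.tangent ∞
        (fun x => (⟨x, A.anchor x (X x)⟩ : TangentBundle I M)) :=
      A.anchor_smooth.comp X.contMDiff
    have h2 := (f.contMDiff.contMDiff_tangentMap (m := ∞) (by simp)).comp h1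
    exact (contMDiff_snd_tangentBundle_modelSpace ℝ 𝓘(ℝ, ℝ)).comp h2

theorem LieAlgebroid.act_add (A : LieAlgebroid I F V) (X : Cₛ^∞⟮I; F, V⟯)
    (f g : C^∞⟮I, M; ℝ⟯) (x : M) : A.act X (f + g) x = A.act X f x + A.act X g x := by
  have hf := (f.contMDiff.mdifferentiable (by simp)) x
  have hg := (g.contMDiff.mdifferentiable (by simp)) x
  have h : mvfderiv I (⇑(f + g)) x = mvfderiv I f x + mvfderiv I g x := mvfderiv_add hf hg
  exact congrArg (fun l => l (A.anchor x (X x))) h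

theorem LieAlgebroid.act_mul (A : LieAlgebroid I F V) (X : Cₛ^∞⟮I; F, V⟯)
    (f g : C^∞⟮I, M; ℝ⟯) (x : M) :
    A.act X (f * g) x = f x * A.act X g x + g x * A.act X f x := by
  have hf := (f.contMDiff.mdifferentiable (by simp)) x
  have hg := (g.contMDiff.mdifferentiable (by simp)) x
  have h : mvfderiv I (⇑(f * g)) x = f x • mvfderiv I g x + g x • mvfderiv I f x :=
    mvfderiv_mul hf hg
  exact congrArg (fun l => l (A.anchor x (X x))) h

theorem LieAlgebroid.bracket_skew (A : LieAlgebroid I F V) (X Y : Cₛ^∞⟮I; F, V⟯) :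
    A.bracket X Y = -A.bracket Y X := by
  have h := A.bracket_self (X + Y)
  simp only [map_add, LinearMap.add_apply, A.bracket_self, zero_add, add_zero] at h
  exact eq_neg_of_add_eq_zero_right h

/-- The value of `d_μ w` on three sections, by the Koszul formula. -/
def LieAlgebroid.koszul (A : LieAlgebroid I F V) (w : AForm I F V 2)
    (X Y Z : Cₛ^∞⟮I; F, V⟯) : C^∞⟮I, M; ℝ⟯ :=
  A.act X (w.evalTwo Y Z) - A.act Y (w.evalTwo X Z) + A.act Z (w.evalTwo X Y)
    - w.evalTwo (A.bracket X Y) Z + w.evalTwo (A.bracket X Z) Y - w.evalTwo (A.bracket Y Z) X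

/-- The value of the Nijenhuis torsion on two sections:
`[NX, NY] - N ([NX, Y] + [X, NY]) + N² [X, Y]`. -/
def LieAlgebroid.torsionSection (A : LieAlgebroid I F V) (N : EndTensor I F V)
    (X Y : Cₛ^∞⟮I; F, V⟯) : Cₛ^∞⟮I; F, V⟯ :=
  A.bracket (N.onSection X) (N.onSection Y)
    - N.onSection (A.bracket (N.onSection X) Y + A.bracket X (N.onSection Y))
    + N.onSection (N.onSection (A.bracket X Y))

theorem LieAlgebroid.act_neg (A : LieAlgebroid I F V) (X : Cₛ^∞⟮I; F, V⟯)
    (f : C^∞⟮I, M; ℝ⟯) (x : M) : A.act X (-f) x = -A.act X f x := by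
  have h : A.act X (f + -f) x = 0 := by
    have h0 := A.act_add X 0 0 x
    rw [add_neg_cancel]
    rw [add_zero] at h0
    linarith
  rw [A.act_add] at h
  linarith

theorem LieAlgebroid.act_add_left (A : LieAlgebroid I F V) (X Y : Cₛ^∞⟮I; F, V⟯)
    (f : C^∞⟮I, M; ℝ⟯) (x : M) : A.act (X + Y) f x = A.act X f x + A.act Y f x := by
  have h : A.anchor x ((X + Y) x) = A.anchor x (X x) + A.anchor x (Y x) :=
    (A.anchor x).map_add _ _
  exact (congrArg (mvfderiv I f x) h).trans ((mvfderiv I f x).map_add _ _)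

theorem LieAlgebroid.act_mul_left (A : LieAlgebroid I F V) (f : C^∞⟮I, M; ℝ⟯)
    (X : Cₛ^∞⟮I; F, V⟯) (g : C^∞⟮I, M; ℝ⟯) (x : M) :
    A.act (mulSection f X) g x = f x * A.act X g x := by
  have h : A.anchor x (mulSection f X x) = f x • A.anchor x (X x) :=
    (A.anchor x).map_smul _ _
  exact (congrArg (mvfderiv I g x) h).trans ((mvfderiv I g x).map_smul _ _)

theorem LieAlgebroid.bracket_mul_right (A : LieAlgebroid I F V) (X : Cₛ^∞⟮I; F, V⟯)
    (f : C^∞⟮I, M; ℝ⟯) (Y : Cₛ^∞⟮I; F, V⟯) :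
    A.bracket X (mulSection f Y) = mulSection f (A.bracket X Y) + mulSection (A.act X f) Y := by
  ext x
  exact A.leibniz X f Y x

theorem LieAlgebroid.bracket_mul_left (A : LieAlgebroid I F V) (f : C^∞⟮I, M; ℝ⟯)
    (X Y : Cₛ^∞⟮I; F, V⟯) :
    A.bracket (mulSection f X) Y = mulSection f (A.bracket X Y) - mulSection (A.act Y f) X := by
  rw [A.bracket_skew, A.bracket_mul_right, A.bracket_skew Y X]
  ext x
  change -(f x • -(A.bracket X Y x) + A.act Y f x • X x) =
    f x • A.bracket X Y x - A.act Y f x • X x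
  rw [smul_neg]
  abel

theorem LieAlgebroid.koszul_apply (A : LieAlgebroid I F V) (w : AForm I F V 2)
    (X Y Z : Cₛ^∞⟮I; F, V⟯) (x : M) : A.koszul w X Y Z x =
      A.act X (w.evalTwo Y Z) x - A.act Y (w.evalTwo X Z) x + A.act Z (w.evalTwo X Y) x
      - w.evalTwo (A.bracket X Y) Z x + w.evalTwo (A.bracket X Z) Y x
      - w.evalTwo (A.bracket Y Z) X x := rfl

theorem LieAlgebroid.koszul_skew (A : LieAlgebroid I F V) (w : AForm I F V 2)
    (X Y Z : Cₛ^∞⟮I; F, V⟯) : A.koszul w X Y Z = -A.koszul w Y X Z := by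
  ext x
  change _ = -A.koszul w Y X Z x
  rw [A.koszul_apply, A.koszul_apply, A.bracket_skew X Y, w.evalTwo_swap X Y, w.evalTwo_neg,
    A.act_neg]
  change _ - -w.evalTwo (A.bracket Y X) Z x + _ - _ = _
  ring

theorem LieAlgebroid.koszul_skew' (A : LieAlgebroid I F V) (w : AForm I F V 2)
    (X Y Z : Cₛ^∞⟮I; F, V⟯) : A.koszul w X Y Z = -A.koszul w X Z Y := by
  ext x
  change _ = -A.koszul w X Z Y x
  rw [A.koszul_apply, A.koszul_apply, A.bracket_skew Y Z, w.evalTwo_swap Y Z, w.evalTwo_neg,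
    A.act_neg]
  change _ - -w.evalTwo (A.bracket Z Y) X x = _
  ring

theorem LieAlgebroid.koszul_add (A : LieAlgebroid I F V) (w : AForm I F V 2)
    (X X' Y Z : Cₛ^∞⟮I; F, V⟯) :
    A.koszul w (X + X') Y Z = A.koszul w X Y Z + A.koszul w X' Y Z := by
  ext x
  change _ = A.koszul w X Y Z x + A.koszul w X' Y Z x
  rw [A.koszul_apply, A.koszul_apply, A.koszul_apply, w.evalTwo_swap _ (X + X'),
    w.evalTwo_swap _ X, w.evalTwo_swap _ X']
  simp only [map_add, LinearMap.add_apply, AForm.evalTwo_add, A.act_add, A.act_add_left,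
    ContMDiffMap.coe_add, ContMDiffMap.coe_neg, Pi.add_apply, Pi.neg_apply]
  ring

theorem LieAlgebroid.koszul_mul (A : LieAlgebroid I F V) (w : AForm I F V 2)
    (f : C^∞⟮I, M; ℝ⟯) (X Y Z : Cₛ^∞⟮I; F, V⟯) :
    A.koszul w (mulSection f X) Y Z = f * A.koszul w X Y Z := by
  ext x
  change _ = f x * A.koszul w X Y Z x
  rw [A.koszul_apply, A.koszul_apply, w.evalTwo_swap _ (mulSection f X), w.evalTwo_swap _ X,
    A.bracket_mul_left, A.bracket_mul_left]
  simp only [sub_eq_add_neg, AForm.evalTwo_add, AForm.evalTwo_neg, AForm.evalTwo_mul, A.act_mul, A.act_mul_left,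
    ContMDiffMap.coe_add, ContMDiffMap.coe_neg, ContMDiffMap.coe_mul, Pi.add_apply, Pi.neg_apply,
    Pi.mul_apply]
  ring

theorem LieAlgebroid.torsionSection_add (A : LieAlgebroid I F V) (N : EndTensor I F V)
    (X X' Y : Cₛ^∞⟮I; F, V⟯) :
    A.torsionSection N (X + X') Y = A.torsionSection N X Y + A.torsionSection N X' Y := by
  simp only [torsionSection, map_add, LinearMap.add_apply]
  abel

theorem LieAlgebroid.torsionSection_skew (A : LieAlgebroid I F V) (N : EndTensor I F V)
    (X Y : Cₛ^∞⟮I; F, V⟯) : A.torsionSection N X Y = -A.torsionSection N Y X := by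
  rw [torsionSection, torsionSection, A.bracket_skew (N.onSection X), A.bracket_skew X Y,
    A.bracket_skew (N.onSection X) Y, A.bracket_skew X (N.onSection Y)]
  simp only [map_add, map_neg]
  abel

theorem LieAlgebroid.torsionSection_mul (A : LieAlgebroid I F V) (N : EndTensor I F V)
    (f : C^∞⟮I, M; ℝ⟯) (X Y : Cₛ^∞⟮I; F, V⟯) :
    A.torsionSection N (mulSection f X) Y = mulSection f (A.torsionSection N X Y) := by
  simp only [torsionSection, N.onSection_mul, A.bracket_mul_left, map_add, map_sub]
  ext x
  change (f x • A.bracket (N.onSection X) (N.onSection Y) x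
      - A.act (N.onSection Y) f x • N.onSection X x)
      - ((f x • N.onSection (A.bracket (N.onSection X) Y) x
          - A.act Y f x • N.onSection (N.onSection X) x)
        + (f x • N.onSection (A.bracket X (N.onSection Y)) x
          - A.act (N.onSection Y) f x • N.onSection X x))
      + (f x • N.onSection (N.onSection (A.bracket X Y)) x
          - A.act Y f x • N.onSection (N.onSection X) x)
    = f x • (A.bracket (N.onSection X) (N.onSection Y) x
      - (N.onSection (A.bracket (N.onSection X) Y) x
        + N.onSection (A.bracket X (N.onSection Y)) x)
      + N.onSection (N.onSection (A.bracket X Y)) x)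
  module

end Geometry

/-! ### Tensoriality: from sections to fibres -/

section Tensoriality

variable {E : Type*} [NormedAddCommGroup E] [NormedSpace ℝ E] [FiniteDimensional ℝ E]
  {H : Type*} [TopologicalSpace H] {I : ModelWithCorners ℝ E H}
  {M : Type*} [TopologicalSpace M] [ChartedSpace H M] [IsManifold I ∞ M] [T2Space M]
  {F : Type*} [NormedAddCommGroup F] [NormedSpace ℝ F] [FiniteDimensional ℝ F]
  {V : M → Type*} [TopologicalSpace (TotalSpace F V)]
  [∀ x, AddCommGroup (V x)] [∀ x, Module ℝ (V x)] [∀ x, TopologicalSpace (V x)]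
  [FiberBundle F V] [VectorBundle ℝ F V] [ContMDiffVectorBundle ∞ F V I]

variable (I F V) in
/-- Near every point there is a frame which extends to global smooth sections, and a smooth cutoff
function `c` with which every smooth section can be expanded in these sections. -/
theorem exists_global_frame (x : M) :
    ∃ (c : C^∞⟮I, M; ℝ⟯) (s : Fin (finrank ℝ F) → Cₛ^∞⟮I; F, V⟯)
      (b : Basis (Fin (finrank ℝ F)) ℝ (V x)),
      c x = 1 ∧ (∀ i, s i x = b i) ∧
      ∀ X : Cₛ^∞⟮I; F, V⟯, ∃ g : Fin (finrank ℝ F) → C^∞⟮I, M; ℝ⟯,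
        mulSection (c * c) X = ∑ i, mulSection (g i) (s i) ∧ ∀ i, g i x = b.repr (X x) i := by
  let t := trivializationAt F V x
  have hx : x ∈ t.baseSet := FiberBundle.mem_baseSet_trivializationAt F V x
  obtain ⟨χ, -, hχ⟩ := ((SmoothBumpFunction.nhds_basis_tsupport (I := I) x).mem_iff).1
    (t.open_baseSet.mem_nhds hx)
  let bF := finBasis ℝ F
  have hs : ∀ i, ContMDiff I (I.prod 𝓘(ℝ, F)) ∞
      (fun y => (⟨y, χ y • t.localFrame bF i y⟩ : TotalSpace F V)) := fun i =>
    ContMDiffOn.smul_section_of_tsupport χ.contMDiff.contMDiffOn t.open_baseSet hχ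
      (t.contMDiffOn_localFrame_baseSet ∞ bF i)
  have hg : ∀ (X : Cₛ^∞⟮I; F, V⟯) i, ContMDiff I 𝓘(ℝ, ℝ) ∞
      (fun y => χ y • t.localFrameCoeff I bF i y (X y)) := fun X i => by
    refine contMDiff_of_tsupport fun y hy => ?_
    have hy' : y ∈ t.baseSet := hχ (tsupport_smul_subset_left _ _ hy)
    exact χ.contMDiff.contMDiffAt.smul
      (contMDiffAt_localFrameCoeff bF hy' X.contMDiff.contMDiffAt i)
  refine ⟨⟨χ, χ.contMDiff⟩, fun i => ⟨_, hs i⟩, t.basisAt bF hx, χ.eq_one, fun i => ?_,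
    fun X => ⟨fun i => ⟨_, hg X i⟩, ?_, fun i => ?_⟩⟩
  · change χ x • t.localFrame bF i x = _
    rw [χ.eq_one, one_smul, t.localFrame_apply_of_mem_baseSet bF hx]
  · ext y
    have h1 : (∑ i, mulSection (⟨_, hg X i⟩ : C^∞⟮I, M; ℝ⟯)
        (⟨_, hs i⟩ : Cₛ^∞⟮I; F, V⟯)) y =
        ∑ i, (χ y • t.localFrameCoeff I bF i y (X y)) • (χ y • t.localFrame bF i y) := by
      have h := congrFun (map_sum (ContMDiffSection.coeAddHom I F ∞ V)
        (fun i => mulSection (⟨_, hg X i⟩ : C^∞⟮I, M; ℝ⟯)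
        (⟨_, hs i⟩ : Cₛ^∞⟮I; F, V⟯)) Finset.univ) y
      rw [Finset.sum_apply] at h
      exact h
    rw [h1]
    change (χ y * χ y) • X y = _
    by_cases hy : y ∈ t.baseSet
    · rw [t.eq_sum_localFrameCoeff_smul (I := I) (b := bF) (s := X) hy, Finset.smul_sum]
      refine Finset.sum_congr rfl fun i _ => ?_
      rw [← t.eq_sum_localFrameCoeff_smul (I := I) (b := bF) (s := X) hy, smul_smul, smul_smul,
        smul_eq_mul]
      congr 1
      ring
    · have h0 : χ y = 0 := image_eq_zero_of_notMem_tsupport fun h => hy (hχ h)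
      simp [h0]
  · change χ x • t.localFrameCoeff I bF i x (X x) = _
    rw [χ.eq_one, one_smul, t.localFrameCoeff_apply_of_mem_baseSet bF hx]

variable (I F) in
/-- A linear choice of smooth sections through the vectors of a fibre. -/
def extendSection (x : M) : V x →ₗ[ℝ] Cₛ^∞⟮I; F, V⟯ :=
  ((exists_global_frame I F V x).choose_spec.choose_spec.choose).constr ℝ
    (exists_global_frame I F V x).choose_spec.choose

theorem extendSection_apply (x : M) (v : V x) : extendSection I F x v x = v := by
  obtain ⟨-, h, -⟩ := (exists_global_frame I F V x).choose_spec.choose_spec.choose_spec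
  set b := (exists_global_frame I F V x).choose_spec.choose_spec.choose with hb
  let ev : Cₛ^∞⟮I; F, V⟯ →ₗ[ℝ] V x :=
    { toFun := fun X => X x
      map_add' := fun _ _ => rfl
      map_smul' := fun _ _ => rfl }
  have h2 : ev ∘ₗ extendSection I F x = LinearMap.id := by
    refine b.ext fun i => ?_
    rw [LinearMap.comp_apply, extendSection, ← hb, b.constr_basis]
    exact h i
  exact LinearMap.congr_fun h2 v

/-- A function of sections which is linear over smooth functions at `x` depends only on the value
of the section at `x`. -/
theorem eq_of_tensorial {A : Type*} [AddCommGroup A] [Module ℝ A] (φ : Cₛ^∞⟮I; F, V⟯ → A) (x : M)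
    (hadd : ∀ X Y, φ (X + Y) = φ X + φ Y)
    (hmul : ∀ (f : C^∞⟮I, M; ℝ⟯) X, φ (mulSection f X) = f x • φ X)
    {X Y : Cₛ^∞⟮I; F, V⟯} (h : X x = Y x) : φ X = φ Y := by
  obtain ⟨c, s, b, hc, hs, hX⟩ := exists_global_frame I F V x
  let ψ : Cₛ^∞⟮I; F, V⟯ →+ A := AddMonoidHom.mk' φ hadd
  have key : ∀ X : Cₛ^∞⟮I; F, V⟯, φ X = ∑ i, b.repr (X x) i • φ (s i) := fun X => by
    obtain ⟨g, h1, h2⟩ := hX X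
    have h3 : φ (mulSection (c * c) X) = φ X := by
      rw [hmul, ContMDiffMap.coe_mul, Pi.mul_apply, hc, mul_one, one_smul]
    have h4 : φ (∑ i, mulSection (g i) (s i)) = ∑ i, φ (mulSection (g i) (s i)) :=
      map_sum ψ _ _
    rw [← h3, h1, h4]
    exact Finset.sum_congr rfl fun i _ => by rw [hmul, h2]
  rw [key X, key Y, h]

theorem LieAlgebroid.koszul_congr (A : LieAlgebroid I F V) (w : AForm I F V 2) {x : M}
    {X X' Y Y' Z Z' : Cₛ^∞⟮I; F, V⟯} (hX : X x = X' x) (hY : Y x = Y' x) (hZ : Z x = Z' x) :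
    A.koszul w X Y Z x = A.koszul w X' Y' Z' x := by
  have h : ∀ {X X' : Cₛ^∞⟮I; F, V⟯} (Y Z : Cₛ^∞⟮I; F, V⟯), X x = X' x →
      A.koszul w X Y Z x = A.koszul w X' Y Z x := fun {X X'} Y Z hX =>
    eq_of_tensorial (fun X => A.koszul w X Y Z x) x
      (fun X X' => by rw [A.koszul_add]; rfl)
      (fun f X => by rw [A.koszul_mul]; rfl) hX
  have h1 : A.koszul w X' Y Z x = A.koszul w X' Y' Z x := by
    rw [A.koszul_skew w X' Y, A.koszul_skew w X' Y']
    exact congrArg Neg.neg (h X' Z hY)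
  have h2 : A.koszul w X' Y' Z x = A.koszul w X' Y' Z' x := by
    rw [A.koszul_skew' w X' Y' Z, A.koszul_skew' w X' Y' Z', A.koszul_skew w X' Z,
      A.koszul_skew w X' Z', neg_neg, neg_neg]
    exact h X' Y' hZ
  exact (h Y Z hX).trans (h1.trans h2)

/-- The Lie algebroid differential `d_μ w` of a `2`-form `w`; its values on sections are given by
the Koszul formula, see `LieAlgebroid.d_apply`. -/
def LieAlgebroid.d (A : LieAlgebroid I F V) (w : AForm I F V 2) : AForm I F V 3 where
  toFun x := (mkAltThree (fun X Y Z : Cₛ^∞⟮I; F, V⟯ => A.koszul w X Y Z x)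
    (fun X X' Y Z => by rw [A.koszul_add]; rfl)
    (fun r X Y Z => congrArg (fun f : C^∞⟮I, M; ℝ⟯ => f x)
      (A.koszul_mul w (ContMDiffMap.const r) X Y Z))
    (fun X Y Z => by rw [A.koszul_skew]; rfl)
    (fun X Y Z => by rw [A.koszul_skew']; rfl)).compLinearMap (extendSection I F x)
  smooth X := (A.koszul w (X 0) (X 1) (X 2)).contMDiff.congr fun x =>
    A.koszul_congr w (extendSection_apply x _) (extendSection_apply x _) (extendSection_apply x _)

theorem LieAlgebroid.d_apply (A : LieAlgebroid I F V) (w : AForm I F V 2)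
    (X Y Z : Cₛ^∞⟮I; F, V⟯) (x : M) :
    (A.d w).toFun x ![X x, Y x, Z x] = A.koszul w X Y Z x :=
  A.koszul_congr w (extendSection_apply x _) (extendSection_apply x _) (extendSection_apply x _)

/-- The Nijenhuis torsion of `N` as a tensor; its values on sections are given by
`LieAlgebroid.torsionSection`, see `LieAlgebroid.torsion_apply`. -/
def LieAlgebroid.torsion (A : LieAlgebroid I F V) (N : EndTensor I F V) (x : M) :
    V x [⋀^Fin 2]→ₗ[ℝ] V x :=
  (mkAltTwo (fun X Y : Cₛ^∞⟮I; F, V⟯ => A.torsionSection N X Y x)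
    (fun X X' Y => by rw [A.torsionSection_add]; rfl)
    (fun r X Y => congrArg (fun s : Cₛ^∞⟮I; F, V⟯ => s x)
      (A.torsionSection_mul N (ContMDiffMap.const r) X Y))
    (fun X Y => by rw [A.torsionSection_skew]; rfl)).compLinearMap (extendSection I F x)

theorem LieAlgebroid.torsion_apply (A : LieAlgebroid I F V) (N : EndTensor I F V)
    (X Y : Cₛ^∞⟮I; F, V⟯) (x : M) :
    A.torsion N x ![X x, Y x] = A.torsionSection N X Y x := by
  have h : ∀ (X X' Y : Cₛ^∞⟮I; F, V⟯), X x = X' x →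
      A.torsionSection N X Y x = A.torsionSection N X' Y x := fun X X' Y hX =>
    eq_of_tensorial (fun X => A.torsionSection N X Y x) x
      (fun X X' => by rw [A.torsionSection_add]; rfl)
      (fun f X => by rw [A.torsionSection_mul]; rfl) hX
  have h' : ∀ (X Y Y' : Cₛ^∞⟮I; F, V⟯), Y x = Y' x →
      A.torsionSection N X Y x = A.torsionSection N X Y' x := fun X Y Y' hY => by
    rw [A.torsionSection_skew N X Y, A.torsionSection_skew N X Y']
    exact congrArg Neg.neg (h Y Y' X hY)
  exact (h _ _ _ (extendSection_apply x _)).trans (h' _ _ _ (extendSection_apply x _))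

end Tensoriality

/-! ### Hitchin pairs -/

section Hitchin

variable {E : Type*} [NormedAddCommGroup E] [NormedSpace ℝ E] [FiniteDimensional ℝ E]
  {H : Type*} [TopologicalSpace H] {I : ModelWithCorners ℝ E H}
  {M : Type*} [TopologicalSpace M] [ChartedSpace H M] [IsManifold I ∞ M] [T2Space M]
  {F : Type*} [NormedAddCommGroup F] [NormedSpace ℝ F] [FiniteDimensional ℝ F]
  {V : M → Type*} [TopologicalSpace (TotalSpace F V)]
  [∀ x, AddCommGroup (V x)] [∀ x, Module ℝ (V x)] [∀ x, TopologicalSpace (V x)]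
  [FiberBundle F V] [VectorBundle ℝ F V] [ContMDiffVectorBundle ∞ F V I]

/-- `(w, N)` is a Hitchin pair: `w` is symplectic (non-degenerate and `d_μ`-closed),
`w^♭ ∘ N = N* ∘ w^♭`, and `d_μ (w_N) = 0`. -/
structure LieAlgebroid.IsHitchinPair (A : LieAlgebroid I F V) (w : AForm I F V 2)
    (N : EndTensor I F V) : Prop where
  nondegenerate : ∀ x, Function.Bijective (w.flat x)
  closed : ∀ x, (A.d w).toFun x = 0
  compatible : ∀ x, w.flat x ∘ₗ N.toFun x = (N.toFun x).dualMap ∘ₗ w.flat x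
  closed_deform : ∀ x, (A.d (w.deform N)).toFun x = 0

/-- The bivector `σ` is the inverse of the `2`-form `w`: `σ^♯ ∘ w^♭ = Id`, where
`σ^♯ α = i_α σ`, that is, `β (σ^♯ α) = σ(α, β)`. -/
def Bivector.IsInverse (σ : Bivector I F V) (w : AForm I F V 2) : Prop :=
  ∀ (x : M) (X : V x) (β : Dual ℝ (V x)), σ.toFun x ![w.flat x X, β] = β X

/-- The twist `-(w + (w_N)_N)`. -/
def AForm.twist (w : AForm I F V 2) (N : EndTensor I F V) : AForm I F V 2 :=
  w.negAdd ((w.deform N).deform N)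

end Hitchin

end

/-! ### The big bracket of a 3-form with a bivector, in one fibre. -/

section FibrewiseAlgebra

variable {W : Type*} [AddCommGroup W] [Module ℝ W] {n : ℕ}

/-! The theorem splits into an identity of Cartan calculus and a contraction in a single fibre.

Cartan calculus: if `ω(NX, Y) = ω(X, NY)`, then for every Lie algebroid `ω(T(X,Y), Z) = dω_N(NX,Y,Z)
+ dω_N(X,NY,Z) - dω(NX,NY,Z) - d(ω_N)_N(X,Y,Z)`, where `T` is the torsion of `N`; this is
`LieAlgebroid.evalTwo_torsionSection`. No closedness enters here: in the Koszul formulas all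
derivatives along the anchor cancel, and so do all brackets except the four terms of the torsion.
For a Hitchin pair only `-d(ω_N)_N` survives on the right, and it equals `dλ` because the summand
`ω` of the twist is closed. Hence `dλ(X,Y,Z) = ω(T(X,Y), Z) = -ω^♭(T(X,Y))(Z)`.

Fibrewise algebra: in `{ψ, σ}` one index of the 3-form `ψ` is contracted with one index of `σ`, so
`σ^♯` is applied to the last slot of `ψ`. If `ψ(X,Y,·) = -ω^♭(T(X,Y))`, then `σ^♯ ∘ ω^♭ = Id` leaves
the tensor `T` itself, with the sign absorbed by the order of the covectors in `torsionElt`. This is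
`bigBracket_formElt_bivectorElt`. -/

theorem contractLeft_dXi_bivectorElt (b : Basis (Fin n) ℝ W) (a : Fin n)
    (σ : Dual ℝ W [⋀^Fin 2]→ₗ[ℝ] ℝ) :
    CliffordAlgebra.contractLeft (dXi b a) (bivectorElt b σ) = 0 := by
  have key : ∀ X Y : W,
      CliffordAlgebra.contractLeft (dXi b a) (vecElt X * vecElt Y) = 0 := fun X Y => by
    have h : CliffordAlgebra.contractLeft (dXi b a) (vecElt X * vecElt Y) =
        dXi b a (X, 0) • vecElt Y -
          vecElt X * CliffordAlgebra.contractLeft (dXi b a) (vecElt Y) :=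
      CliffordAlgebra.contractLeft_ι_mul _ _ _
    rw [h, contractLeft_vecElt]
    simp [dXi]
  simp [bivectorElt, key]

/-- The derivative hits either factor of `θ_p θ_c`. By skew-symmetry of `σ` the two contributions
agree, which cancels the factor `1/2` in `bivectorElt`. -/
theorem contractLeft_dTheta_bivectorElt (b : Basis (Fin n) ℝ W) (a : Fin n)
    (σ : Dual ℝ W [⋀^Fin 2]→ₗ[ℝ] ℝ) :
    CliffordAlgebra.contractLeft (dTheta b a) (bivectorElt b σ) =
      ∑ c, σ ![b.coord a, b.coord c] • vecElt (b c) := by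
  have key : ∀ X Y : W, CliffordAlgebra.contractLeft (dTheta b a) (vecElt X * vecElt Y) =
      b.coord a X • vecElt Y - b.coord a Y • vecElt X := fun X Y => by
    have h : CliffordAlgebra.contractLeft (dTheta b a) (vecElt X * vecElt Y) =
        dTheta b a (X, 0) • vecElt Y -
          vecElt X * CliffordAlgebra.contractLeft (dTheta b a) (vecElt Y) :=
      CliffordAlgebra.contractLeft_ι_mul _ _ _
    rw [h, contractLeft_vecElt, ← Algebra.commutes, ← Algebra.smul_def]
    rfl
  have h1 : ∑ p, ∑ c, (σ ![b.coord p, b.coord c] * b.coord a (b p)) • vecElt (b c) =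
      ∑ c, σ ![b.coord a, b.coord c] • vecElt (b c) := by
    rw [Finset.sum_eq_single a]
    · simp
    · intro p _ hp
      simp [hp]
    · simp
  -- Here the second factor is hit: its index is set to `a`, and swapping the arguments of `σ`
  -- produces the sign.
  have h2 : ∑ p, ∑ c, (σ ![b.coord p, b.coord c] * b.coord a (b c)) • vecElt (b p) =
      -∑ c, σ ![b.coord a, b.coord c] • vecElt (b c) := by
    rw [← Finset.sum_neg_distrib]
    refine Finset.sum_congr rfl fun p _ => ?_
    rw [Finset.sum_eq_single a]
    · simp [alternatingTwo_swap σ (b.coord p)]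
    · intro c _ hc
      simp [hc]
    · simp
  simp only [bivectorElt, map_smul, map_sum, key, smul_sub, Finset.sum_sub_distrib, smul_smul]
  rw [h1, h2]
  module

theorem contractRight_covecElt_mul_three (d : Dual ℝ (W × Dual ℝ W)) (α β γ : Dual ℝ W) :
    CliffordAlgebra.contractRight (covecElt α * covecElt β * covecElt γ) d =
      d (0, γ) • (covecElt α * covecElt β) - d (0, β) • (covecElt α * covecElt γ) +
        d (0, α) • (covecElt β * covecElt γ) := by
  have h : ∀ (u : TensorAlg W) (δ : Dual ℝ W),
      CliffordAlgebra.contractRight (u * covecElt δ) d =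
        d (0, δ) • u - CliffordAlgebra.contractRight u d * covecElt δ :=
    fun u δ => CliffordAlgebra.contractRight_mul_ι _ _ _
  rw [h, h, contractRight_covecElt, ← Algebra.smul_def, sub_mul, smul_mul_assoc, smul_mul_assoc]
  abel

theorem sum_fin_three {A : Type*} [AddCommMonoid A] (f : (Fin 3 → Fin n) → A) :
    ∑ i, f i = ∑ p, ∑ q, ∑ r, f ![p, q, r] := by
  rw [← (Fin.consEquiv fun _ : Fin 3 => Fin n).sum_comp, Fintype.sum_prod_type]
  refine Finset.sum_congr rfl fun p _ => ?_
  rw [← (Fin.consEquiv fun _ : Fin 2 => Fin n).sum_comp, Fintype.sum_prod_type]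
  refine Finset.sum_congr rfl fun q _ => ?_
  rw [← (Fin.consEquiv fun _ : Fin 1 => Fin n).sum_comp, Fintype.sum_prod_type]
  refine Finset.sum_congr rfl fun r _ => ?_
  rw [Fintype.sum_unique]
  congr 1

/-- Each of the three positions can absorb the derivative. Moving the index `a` to the last slot of
`ψ` compensates the sign of the contraction, so the three contributions are equal and `3/3! = 1/2`.
-/
theorem contractRight_dXi_formElt (b : Basis (Fin n) ℝ W) (a : Fin n)
    (ψ : W [⋀^Fin 3]→ₗ[ℝ] ℝ) :
    CliffordAlgebra.contractRight (formElt b ψ) (dXi b a) =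
      (2 : ℝ)⁻¹ • ∑ p, ∑ q,
        ψ ![b p, b q, b a] • (covecElt (b.coord p) * covecElt (b.coord q)) := by
  have hδ : ∀ f : Fin n → TensorAlg W, ∑ r, b.coord r (b a) • f r = f a := fun f => by
    rw [Finset.sum_eq_single a]
    · simp
    · intro r _ hr
      simp [hr.symm]
    · simp
  have hswap : ∀ X Y Z, ψ ![X, Y, Z] = -ψ ![X, Z, Y] := fun X Y Z => by
    rw [← ψ.map_swap ![X, Z, Y] (show (1 : Fin 3) ≠ 2 by decide)]
    congr 1
    ext i
    fin_cases i <;> rfl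
  have hswap' : ∀ X Y Z, ψ ![X, Y, Z] = -ψ ![Y, X, Z] := fun X Y Z => by
    rw [← ψ.map_swap ![Y, X, Z] (show (0 : Fin 3) ≠ 1 by decide)]
    congr 1
    ext i
    fin_cases i <;> rfl
  have hψ : ∀ p q r : Fin n, (fun j => b (![p, q, r] j)) = ![b p, b q, b r] := fun p q r => by
    ext i
    fin_cases i <;> rfl
  have hprod : ∀ p q r : Fin n, (List.ofFn fun j => covecElt (b.coord (![p, q, r] j))).prod =
      covecElt (b.coord p) * covecElt (b.coord q) * covecElt (b.coord r) := fun p q r => by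
    simp [List.ofFn_succ, mul_assoc]
  have hd : ∀ p, dXi b a (0, b.coord p) = b.coord p (b a) := fun _ => rfl
  set S := ∑ p, ∑ q, ψ ![b p, b q, b a] • (covecElt (b.coord p) * covecElt (b.coord q)) with hS
  have h1 : ∑ p, ∑ q, ∑ r, b.coord r (b a) •
      ψ ![b p, b q, b r] • (covecElt (b.coord p) * covecElt (b.coord q)) = S := by
    simp only [hδ, hS]
  have h2 : ∑ p, ∑ q, ∑ r, b.coord q (b a) •
      ψ ![b p, b q, b r] • (covecElt (b.coord p) * covecElt (b.coord r)) = -S := by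
    simp only [← Finset.smul_sum, hδ, hS, ← Finset.sum_neg_distrib, ← neg_smul, ← hswap]
  have h3 : ∑ p, ∑ q, ∑ r, b.coord p (b a) •
      ψ ![b p, b q, b r] • (covecElt (b.coord q) * covecElt (b.coord r)) = S := by
    simp only [← Finset.smul_sum, hδ, hS]
    refine Finset.sum_congr rfl fun q _ => Finset.sum_congr rfl fun r _ => ?_
    rw [hswap', hswap, neg_neg]
  -- The summands `S`, `-S`, `S` come from removing the third, second and first covector, and the
  -- alternating signs are those of the right contraction.
  have h4 : CliffordAlgebra.contractRight (formElt b ψ) (dXi b a) =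
      ((Nat.factorial 3 : ℝ)⁻¹) • (S - -S + S) := by
    nth_rewrite 1 [← h1]
    rw [← h2, ← h3]
    simp only [formElt, sum_fin_three, hψ, hprod, map_smul, map_sum, LinearMap.smul_apply,
      LinearMap.sum_apply, contractRight_covecElt_mul_three, hd, ← Finset.sum_sub_distrib,
      ← Finset.sum_add_distrib, smul_add, smul_sub, smul_comm (ψ _)]
  rw [h4, show (Nat.factorial 3 : ℝ) = 6 by norm_num [Nat.factorial]]
  module

/-- In coordinates the bracket is `(1/2) ψ_{pqa} σ^{ac} ξ^p ξ^q θ_c`. Substituting `ψ_{pqa} =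
-φ(T(b_p, b_q))_a`, the sum over `a` and `c` reassembles the vector `T(b_p, b_q)` because `σ`
inverts `φ`. -/
theorem bigBracket_formElt_bivectorElt (b : Basis (Fin n) ℝ W) (T : W [⋀^Fin 2]→ₗ[ℝ] W)
    (φ : W →ₗ[ℝ] Dual ℝ W) (σ : Dual ℝ W [⋀^Fin 2]→ₗ[ℝ] ℝ) (ψ : W [⋀^Fin 3]→ₗ[ℝ] ℝ)
    (hσ : ∀ X β, σ ![φ X, β] = β X) (hψ : ∀ X Y Z, ψ ![X, Y, Z] = -φ (T ![X, Y]) Z) :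
    bigBracket b (formElt b ψ) (bivectorElt b σ) = torsionElt b T := by
  -- The hypothesis `hσ` after expanding `φ X` in the dual basis.
  have h1 : ∀ X β, ∑ a, φ X (b a) * σ ![b.coord a, β] = β X := fun X β => by
    let g : Dual ℝ W →ₗ[ℝ] ℝ :=
      { toFun := fun α => σ ![α, β]
        map_add' := fun α α' => σ.map_vecCons_add ![β] α α'
        map_smul' := fun r α => σ.map_vecCons_smul ![β] r α }
    have h : φ X = ∑ a, φ X (b a) • b.coord a := by
      ext Y
      simp [mul_comm, ← sum_coord_mul_coord b Y (φ X)]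
    have h' := congrArg g h
    rw [map_sum] at h'
    simp only [map_smul] at h'
    exact h'.symm.trans (hσ X β)
  -- The coordinate form of `X = σ^♯(φ X)`.
  have h2 : ∀ X : W, vecElt X =
      ∑ a, ∑ c, φ X (b a) • σ ![b.coord a, b.coord c] • vecElt (b c) := fun X => by
    rw [Finset.sum_comm]
    simp only [smul_smul, ← Finset.sum_smul, h1]
    simp only [← map_smul, ← map_sum, b.coord_apply, b.sum_repr]
  have hskew : ∀ α β : Dual ℝ W, covecElt α * covecElt β = -(covecElt β * covecElt α) :=
    fun α β => eq_neg_of_add_eq_zero_left (ExteriorAlgebra.ι_add_mul_swap _ _)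
  -- Only one half of the bracket remains, since a bivector contains no `ξ`.
  simp only [bigBracket, contractLeft_dXi_bivectorElt, mul_zero, add_zero,
    contractLeft_dTheta_bivectorElt, contractRight_dXi_formElt, torsionElt, smul_mul_assoc,
    ← Finset.smul_sum]
  congr 1
  simp only [Finset.sum_mul]
  rw [Finset.sum_comm]
  refine Finset.sum_congr rfl fun p _ => ?_
  rw [Finset.sum_comm]
  refine Finset.sum_congr rfl fun q _ => ?_
  -- `torsionElt` lists the covectors in the order `ξ^q ξ^p`; the sign of the swap matches the minus
  -- in `hψ`.
  rw [h2 (T _), hskew (b.coord q), neg_mul, Finset.mul_sum, ← Finset.sum_neg_distrib]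
  refine Finset.sum_congr rfl fun a _ => ?_
  rw [hψ, ← Finset.smul_sum, mul_smul_comm, smul_mul_assoc, neg_smul]

end FibrewiseAlgebra

/-! ### The torsion of `N` in terms of Lie algebroid differentials. -/

section TorsionOfSections

variable {E : Type*} [NormedAddCommGroup E] [NormedSpace ℝ E]
  {H : Type*} [TopologicalSpace H] {I : ModelWithCorners ℝ E H}
  {M : Type*} [TopologicalSpace M] [ChartedSpace H M]
  {F : Type*} [NormedAddCommGroup F] [NormedSpace ℝ F]
  {V : M → Type*} [TopologicalSpace (TotalSpace F V)]
  [∀ x, AddCommGroup (V x)] [∀ x, Module ℝ (V x)] [∀ x, TopologicalSpace (V x)]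
  [FiberBundle F V] [VectorBundle ℝ F V]

/-- Under the symmetry `h` the two terms of `i_N w` coincide, so the factor `1/2` disappears. -/
theorem AForm.evalTwo_deform (w : AForm I F V 2) (N : EndTensor I F V)
    (h : ∀ X Y, w.evalTwo (N.onSection X) Y = w.evalTwo X (N.onSection Y))
    (X Y : Cₛ^∞⟮I; F, V⟯) : (w.deform N).evalTwo X Y = w.evalTwo (N.onSection X) Y := by
  ext x
  have h1 : (w.deform N).evalTwo X Y x =
      (2 : ℝ)⁻¹ * (w.evalTwo (N.onSection X) Y x + w.evalTwo X (N.onSection Y) x) := rfl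
  rw [h1, ← h]
  ring

variable [IsManifold I ∞ M]

theorem LieAlgebroid.koszul_negAdd (A : LieAlgebroid I F V) (w η : AForm I F V 2)
    (X Y Z : Cₛ^∞⟮I; F, V⟯) (x : M) :
    A.koszul (w.negAdd η) X Y Z x = -(A.koszul w X Y Z x + A.koszul η X Y Z x) := by
  have h : ∀ X Y, (w.negAdd η).evalTwo X Y = -(w.evalTwo X Y + η.evalTwo X Y) :=
    fun _ _ => rfl
  simp only [A.koszul_apply, h, A.act_neg, A.act_add, ContMDiffMap.coe_add,
    ContMDiffMap.coe_neg, Pi.add_apply, Pi.neg_apply]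
  ring

/-- If `w(N X, Y) = w(X, N Y)`, the torsion of `N` is expressed by the differentials of `w`, `w_N`
and `(w_N)_N`. -/
theorem LieAlgebroid.evalTwo_torsionSection (A : LieAlgebroid I F V) (w : AForm I F V 2)
    (N : EndTensor I F V) (h : ∀ X Y, w.evalTwo (N.onSection X) Y = w.evalTwo X (N.onSection Y))
    (X Y Z : Cₛ^∞⟮I; F, V⟯) (x : M) :
    w.evalTwo (A.torsionSection N X Y) Z x =
      A.koszul (w.deform N) (N.onSection X) Y Z x + A.koszul (w.deform N) X (N.onSection Y) Z x
        - A.koszul w (N.onSection X) (N.onSection Y) Z x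
        - A.koszul ((w.deform N).deform N) X Y Z x := by
  have h1 := w.evalTwo_deform N h
  -- The form `w_N` inherits the symmetry with respect to `N`, so the same formula applies to
  -- `(w_N)_N`, whose value is `w(N²X, Y)`.
  have h2 := (w.deform N).evalTwo_deform N fun X Y => by rw [h1, h1, h]
  simp only [A.koszul_apply, h1, h2, torsionSection, sub_eq_add_neg, AForm.evalTwo_add,
    AForm.evalTwo_neg, map_add, ContMDiffMap.coe_add, ContMDiffMap.coe_neg, Pi.add_apply,
    Pi.neg_apply]
  -- Moving every `N` into the second argument gives a normal form in which the remaining terms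
  -- cancel as real numbers.
  simp only [h]
  ring

end TorsionOfSections

/-! ### The torsion of a Hitchin pair. -/

theorem mainTheorem11
    {E : Type*} [NormedAddCommGroup E] [NormedSpace ℝ E] [FiniteDimensional ℝ E]
    {H : Type*} [TopologicalSpace H] {I : ModelWithCorners ℝ E H}
    {M : Type*} [TopologicalSpace M] [ChartedSpace H M] [IsManifold I ∞ M] [T2Space M]
    {F : Type*} [NormedAddCommGroup F] [NormedSpace ℝ F] [FiniteDimensional ℝ F]
    {V : M → Type*} [TopologicalSpace (TotalSpace F V)]
    [∀ x, AddCommGroup (V x)] [∀ x, Module ℝ (V x)] [∀ x, TopologicalSpace (V x)]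
    [FiberBundle F V] [VectorBundle ℝ F V] [ContMDiffVectorBundle ∞ F V I]
    (A : LieAlgebroid I F V) (w : AForm I F V 2) (N : EndTensor I F V) (σ : Bivector I F V)
    (hwN : A.IsHitchinPair w N) (hσ : σ.IsInverse w)
    (x : M) {n : ℕ} (b : Basis (Fin n) ℝ (V x)) :
    torsionElt b (A.torsion N x) =
      bigBracket b (formElt b ((A.d (w.twist N)).toFun x)) (bivectorElt b (σ.toFun x)) := by
  refine (bigBracket_formElt_bivectorElt b _ (w.flat x) _ _ (hσ x) fun v₁ v₂ v₃ => ?_).symm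
  -- The Koszul formula and the torsion are defined on sections, so the three vectors are extended
  -- to global sections; by tensoriality the choice is immaterial.
  obtain ⟨X, rfl⟩ : ∃ X : Cₛ^∞⟮I; F, V⟯, X x = v₁ := ⟨_, extendSection_apply x v₁⟩
  obtain ⟨Y, rfl⟩ : ∃ Y : Cₛ^∞⟮I; F, V⟯, Y x = v₂ := ⟨_, extendSection_apply x v₂⟩
  obtain ⟨Z, rfl⟩ : ∃ Z : Cₛ^∞⟮I; F, V⟯, Z x = v₃ := ⟨_, extendSection_apply x v₃⟩
  have hN : ∀ X Y, w.evalTwo (N.onSection X) Y = w.evalTwo X (N.onSection Y) := fun X Y => by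
    ext y
    -- The convention `w^♭ X = -i_X w` puts a minus on both sides of the compatibility condition.
    exact neg_injective (LinearMap.congr_fun (LinearMap.congr_fun (hwN.compatible y) (X y)) (Y y))
  have h1 : ∀ X Y Z, A.koszul w X Y Z x = 0 := fun X Y Z => by
    rw [← A.d_apply, hwN.closed, AlternatingMap.zero_apply]
  have h2 : ∀ X Y Z, A.koszul (w.deform N) X Y Z x = 0 := fun X Y Z => by
    rw [← A.d_apply, hwN.closed_deform, AlternatingMap.zero_apply]
  have h3 := A.evalTwo_torsionSection w N hN X Y Z x
  have h4 : -w.flat x (A.torsionSection N X Y x) (Z x) =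
      w.evalTwo (A.torsionSection N X Y) Z x := neg_neg _
  -- Closedness of `w` is used twice: for the summand `w` of the twist, and for the term at `(NX,
  -- NY, Z)` in the torsion identity. Closedness of `w_N` removes the other two terms.
  rw [A.torsion_apply, A.d_apply, AForm.twist, A.koszul_negAdd, h4, h3, h1, h1, h2, h2]
  ring
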